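/- Let $A$ and $B$ be density matrices in $M_n(\mathbb{C})$, i.e. positive semidefinite matrices of trace one, with $\operatorname{supp} A\subseteq\operatorname{supp} B$, where the support of a Hermitian matrix is the orthogonal complement of its kernel. For $t>0$ let $$\mathcal{F}_t(A|B)=\operatorname{tr}\Bigl(\bigl(B^{\frac{1-t}{2t}}\,A\,B^{\frac{1-t}{2t}}\bigr)^{t}\Bigr)$$ be the sandwiched quasi-relative entropy. Then $\mathcal{F}_t(A|B)>0$ for every $t\in[\tfrac12,1]$, and the function $t\mapsto\ln\mathcal{F}_t(A|B)$ is convex on $[\tfrac12,1]$; that is, $t\mapsto\mathcal{F}_t(A|B)$ is log-convex on $[\tfrac12,1]$. -/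

import Mathlib

open scoped MatrixOrder ComplexOrder

/-- A density matrix: a positive semidefinite complex matrix of trace one. -/
def IsDensityMatrix {n : Type*} [Fintype n] (A : Matrix n n ℂ) : Prop :=
  A.PosSemidef ∧ A.trace = 1

/-- The support of a (Hermitian) matrix: the orthogonal complement of its kernel in the Euclidean
space `ℂⁿ`. -/
noncomputable def matrixSupport {n : Type*} [Fintype n] [DecidableEq n] (A : Matrix n n ℂ) :
    Submodule ℂ (EuclideanSpace ℂ n) :=
  (LinearMap.ker (Matrix.toEuclideanLin A))ᗮ

/-- The sandwiched quasi-relative entropy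
`𝓕_t(A|B) = tr (B^((1-t)/(2t)) A B^((1-t)/(2t)))^t`. The real powers of positive semidefinite
matrices are those of the continuous functional calculus, and the trace is that of a positive
semidefinite matrix, hence a real number, which the real part extracts. At `t = 1` the power `B ^ 0`
is the identity; when `supp A ⊆ supp B` the projection onto `supp B` in its place would give the
same value. -/
noncomputable def sandwichedQuasiEntropy {n : Type*} [Fintype n] [DecidableEq n]
    (A B : Matrix n n ℂ) (t : ℝ) : ℝ :=
  (Matrix.trace ((B ^ ((1 - t) / (2 * t)) * A * B ^ ((1 - t) / (2 * t))) ^ t)).re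

/-! Put `u = 1/(2t)` and `Y_u = A^(1/2) B^(u-1/2)`. Then `F_t = tr |Y_u|^(1/u)`, so `F_t^u` is the
Schatten norm of `Y_u` with exponent `1/u`; the bound `t ≥ 1/2` says that `u ≤ 1`. Since `Y_u` is
analytic in `u`, complex interpolation makes `u ↦ u ln F` convex, and passing to `t = 1/(2u)` (a
perspective transform) gives convexity of `ln F` in `t`. The interpolation is `trace_interpolation`:
the three lines theorem applied to a trace that pairs `Y_z` with a dual family built from the polar
decomposition at the intermediate point. The boundary estimate `norm_trace_polar_le` is Hölder's
inequality for traces, reduced to doubly substochastic weights. Singular `B` is handled by powers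
taken on the support only; the inclusion of supports lets `A` absorb the projection that replaces
`B^0`. -/

/-- The complex power `x ↦ x ^ z` of a nonnegative real, with value `0` at `x = 0` for every
exponent, so that `suppPow 0` is the indicator of the nonzero reals. -/
noncomputable def suppPow (z : ℂ) (x : ℝ) : ℂ :=
  if x = 0 then 0 else Complex.exp (z * (Real.log x : ℂ))

lemma suppPow_add (z w : ℂ) (x : ℝ) : suppPow (z + w) x = suppPow z x * suppPow w x := by
  by_cases hx : x = 0
  · simp [suppPow, hx]
  · simp [suppPow, hx, add_mul, Complex.exp_add]

/-- The side condition excludes `0 ^ 0`, which is `1` for `Real.rpow` and `0` for `suppPow`. -/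
lemma suppPow_ofReal {r x : ℝ} (hx : 0 ≤ x) (h : x = 0 → r ≠ 0) :
    suppPow r x = ((x ^ r : ℝ) : ℂ) := by
  by_cases h0 : x = 0
  · simp [suppPow, h0, Real.zero_rpow (h h0)]
  · rw [suppPow, if_neg h0, Real.rpow_def_of_pos (lt_of_le_of_ne hx (Ne.symm h0)), mul_comm]
    push_cast
    rfl

lemma suppPow_one {x : ℝ} (hx : 0 ≤ x) : suppPow 1 x = x := by
  simpa using suppPow_ofReal (r := 1) hx (fun _ => one_ne_zero)

lemma norm_suppPow_le {z : ℂ} {x : ℝ} (hx : 0 ≤ x) : ‖suppPow z x‖ ≤ x ^ z.re := by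
  by_cases h0 : x = 0
  · simp only [suppPow, h0, if_true, norm_zero]
    positivity
  · rw [suppPow, if_neg h0, Complex.norm_exp,
      Real.rpow_def_of_pos (lt_of_le_of_ne hx (Ne.symm h0)), mul_comm]
    simp

lemma star_suppPow (r x : ℝ) : star (suppPow r x) = suppPow r x := by
  by_cases h0 : x = 0
  · simp [suppPow, h0]
  · simp only [suppPow, if_neg h0]
    rw [Complex.star_def, ← Complex.exp_conj]
    simp

lemma differentiable_suppPow (x : ℝ) : Differentiable ℂ fun z => suppPow z x := by
  by_cases h0 : x = 0
  · simp [suppPow, h0]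
  · simp only [suppPow, if_neg h0]
    fun_prop

/-! ### Complex functional calculus of a Hermitian matrix. -/

namespace Matrix.IsHermitian

variable {n : Type*} [Fintype n] [DecidableEq n]

/-- The functional calculus of a Hermitian matrix for complex-valued functions of a real
variable. -/
noncomputable def complexCfc {H : Matrix n n ℂ} (hH : H.IsHermitian) (f : ℝ → ℂ) : Matrix n n ℂ :=
  hH.eigenvectorUnitary.1 * diagonal (fun i => f (hH.eigenvalues i)) *
    hH.eigenvectorUnitary.1ᴴ

variable {H : Matrix n n ℂ} (hH : H.IsHermitian)

lemma conjTranspose_mul_eigenvectorUnitary :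
    hH.eigenvectorUnitary.1ᴴ * hH.eigenvectorUnitary.1 = 1 :=
  Unitary.coe_star_mul_self hH.eigenvectorUnitary

lemma complexCfc_mul (f g : ℝ → ℂ) :
    hH.complexCfc f * hH.complexCfc g = hH.complexCfc (fun x => f x * g x) := by
  simp only [complexCfc]
  calc _ = hH.eigenvectorUnitary.1 * diagonal (fun i => f (hH.eigenvalues i)) *
        (hH.eigenvectorUnitary.1ᴴ * hH.eigenvectorUnitary.1) *
        diagonal (fun i => g (hH.eigenvalues i)) * hH.eigenvectorUnitary.1ᴴ := by
        simp only [Matrix.mul_assoc]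
    _ = _ := by
        rw [conjTranspose_mul_eigenvectorUnitary, Matrix.mul_one,
          Matrix.mul_assoc hH.eigenvectorUnitary.1, diagonal_mul_diagonal]

lemma complexCfc_congr {f g : ℝ → ℂ} (h : ∀ i, f (hH.eigenvalues i) = g (hH.eigenvalues i)) :
    hH.complexCfc f = hH.complexCfc g := by
  simp only [complexCfc, h]

lemma conjTranspose_complexCfc (f : ℝ → ℂ) :
    (hH.complexCfc f)ᴴ = hH.complexCfc (fun x => star (f x)) := by
  simp only [complexCfc, conjTranspose_mul, conjTranspose_conjTranspose, diagonal_conjTranspose,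
    Matrix.mul_assoc]
  rfl

lemma trace_complexCfc (f : ℝ → ℂ) :
    (hH.complexCfc f).trace = ∑ i, f (hH.eigenvalues i) := by
  rw [complexCfc, trace_mul_comm, ← Matrix.mul_assoc, conjTranspose_mul_eigenvectorUnitary,
    Matrix.one_mul, trace_diagonal]

lemma complexCfc_ofReal (f : ℝ → ℝ) : hH.complexCfc (fun x => (f x : ℂ)) = _root_.cfc f H := by
  rw [hH.cfc_eq, IsHermitian.cfc, Unitary.conjStarAlgAut_apply]
  rfl

lemma complexCfc_id : hH.complexCfc (fun x => (x : ℂ)) = H := by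
  conv_rhs => rw [hH.spectral_theorem, Unitary.conjStarAlgAut_apply]
  rfl

lemma complexCfc_suppPow_mul (z w : ℂ) :
    hH.complexCfc (suppPow z) * hH.complexCfc (suppPow w) = hH.complexCfc (suppPow (z + w)) := by
  rw [complexCfc_mul]
  exact hH.complexCfc_congr fun i => (suppPow_add z w _).symm

lemma conjTranspose_complexCfc_suppPow (r : ℝ) :
    (hH.complexCfc (suppPow r))ᴴ = hH.complexCfc (suppPow r) := by
  rw [conjTranspose_complexCfc]
  exact hH.complexCfc_congr fun i => star_suppPow r _

open scoped Matrix.Norms.L2Operator in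
lemma norm_eigenvectorUnitary_le_one : ‖hH.eigenvectorUnitary.1‖ ≤ 1 := by
  have h := l2_opNorm_conjTranspose_mul_self hH.eigenvectorUnitary.1
  have h1 : ‖(1 : Matrix n n ℂ)‖ ≤ 1 := by
    rw [← diagonal_one, l2_opNorm_diagonal]
    exact (pi_norm_le_iff_of_nonneg zero_le_one).2 fun i => by simp
  rw [conjTranspose_mul_eigenvectorUnitary] at h
  nlinarith [norm_nonneg hH.eigenvectorUnitary.1]

open scoped Matrix.Norms.L2Operator in
lemma norm_complexCfc_le_one {f : ℝ → ℂ} (hf : ∀ i, ‖f (hH.eigenvalues i)‖ ≤ 1) :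
    ‖hH.complexCfc f‖ ≤ 1 := by
  have hD : ‖(diagonal (fun i => f (hH.eigenvalues i)) : Matrix n n ℂ)‖ ≤ 1 := by
    rw [l2_opNorm_diagonal]
    exact (pi_norm_le_iff_of_nonneg zero_le_one).2 hf
  have hU := hH.norm_eigenvectorUnitary_le_one
  have hU' : ‖hH.eigenvectorUnitary.1ᴴ‖ ≤ 1 := (l2_opNorm_conjTranspose _).le.trans hU
  calc _ ≤ ‖hH.eigenvectorUnitary.1‖ * ‖(diagonal (fun i => f (hH.eigenvalues i)) : Matrix n n ℂ)‖
        * ‖hH.eigenvectorUnitary.1ᴴ‖ := norm_mul₃_le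
    _ ≤ 1 * 1 * 1 := by gcongr
    _ = 1 := by norm_num

end Matrix.IsHermitian

/-! ### Hölder's inequality for traces and the polar decomposition. -/

namespace Matrix

variable {n : Type*} [Fintype n] [DecidableEq n]

lemma PosSemidef.complexCfc_suppPow_one {H : Matrix n n ℂ} (hH : H.PosSemidef) :
    hH.1.complexCfc (suppPow 1) = H := by
  conv_rhs => rw [← hH.1.complexCfc_id]
  exact hH.1.complexCfc_congr fun i => suppPow_one (hH.eigenvalues_nonneg i)

lemma PosSemidef.complexCfc_suppPow_ofReal {H : Matrix n n ℂ} (hH : H.PosSemidef) {r : ℝ}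
    (hr : r ≠ 0) : hH.1.complexCfc (suppPow r) = H ^ r := by
  rw [CFC.rpow_eq_cfc_real hH.nonneg, ← hH.1.complexCfc_ofReal]
  exact hH.1.complexCfc_congr fun i => suppPow_ofReal (hH.eigenvalues_nonneg i) fun _ => hr

lemma PosSemidef.trace_rpow {H : Matrix n n ℂ} (hH : H.PosSemidef) (r : ℝ) :
    (H ^ r).trace = ((∑ i, hH.1.eigenvalues i ^ r : ℝ) : ℂ) := by
  rw [CFC.rpow_eq_cfc_real hH.nonneg, ← hH.1.complexCfc_ofReal, hH.1.trace_complexCfc]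
  push_cast
  rfl

open scoped Matrix.Norms.L2Operator in
lemma sum_norm_sq_col_le_one {K : Matrix n n ℂ} (hK : ‖K‖ ≤ 1) (j : n) :
    ∑ i, ‖K i j‖ ^ 2 ≤ 1 := by
  have h := l2_opNorm_mulVec K (EuclideanSpace.single j 1)
  have h1 : ‖(EuclideanSpace.single j 1 : EuclideanSpace ℂ n)‖ = 1 := by simp
  rw [h1, mul_one] at h
  have h2 := h.trans hK
  rw [EuclideanSpace.norm_eq, Real.sqrt_le_one] at h2
  simpa using h2

open scoped Matrix.Norms.L2Operator in
lemma sum_norm_sq_row_le_one {K : Matrix n n ℂ} (hK : ‖K‖ ≤ 1) (i : n) :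
    ∑ j, ‖K i j‖ ^ 2 ≤ 1 := by
  have h := sum_norm_sq_col_le_one (K := Kᴴ) (by rwa [l2_opNorm_conjTranspose]) i
  simpa using h

/-- Hölder's inequality for doubly substochastic weights. -/
lemma sum_mul_rpow_mul_rpow_le {ι : Type*} [Fintype ι] {w : ι → ι → ℝ} (hw : ∀ i j, 0 ≤ w i j)
    (hrow : ∀ i, ∑ j, w i j ≤ 1) (hcol : ∀ j, ∑ i, w i j ≤ 1) {α β : ι → ℝ}
    (hα : ∀ i, 0 ≤ α i) (hβ : ∀ j, 0 ≤ β j) (hSα : 0 < ∑ i, α i) (hSβ : 0 < ∑ j, β j)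
    {u : ℝ} (hu0 : 0 ≤ u) (hu1 : u ≤ 1) :
    ∑ i, ∑ j, w i j * (α i ^ u * β j ^ (1 - u)) ≤
      (∑ i, α i) ^ u * (∑ j, β j) ^ (1 - u) := by
  set S := ∑ i, α i with hS
  set T := ∑ j, β j with hT
  -- Weighted AM-GM for the normalised quantities `α i / S` and `β j / T`.
  have key : ∀ i j, α i ^ u * β j ^ (1 - u) ≤
      S ^ u * T ^ (1 - u) * (u * (α i / S) + (1 - u) * (β j / T)) := by
    intro i j
    have h := Real.geom_mean_le_arith_mean2_weighted hu0 (sub_nonneg.2 hu1)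
      (div_nonneg (hα i) hSα.le) (div_nonneg (hβ j) hSβ.le) (by ring)
    rw [Real.div_rpow (hα i) hSα.le, Real.div_rpow (hβ j) hSβ.le] at h
    have hS' := Real.rpow_pos_of_pos hSα u
    have hT' := Real.rpow_pos_of_pos hSβ (1 - u)
    calc _ = S ^ u * T ^ (1 - u) * (α i ^ u / S ^ u * (β j ^ (1 - u) / T ^ (1 - u))) := by
          field_simp
      _ ≤ _ := by gcongr
  have h1 : ∑ i, ∑ j, w i j * (α i / S) ≤ 1 := by
    calc _ = ∑ i, (∑ j, w i j) * (α i / S) := by simp only [Finset.sum_mul]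
      _ ≤ ∑ i, 1 * (α i / S) := Finset.sum_le_sum fun i _ =>
          mul_le_mul_of_nonneg_right (hrow i) (div_nonneg (hα i) hSα.le)
      _ = 1 := by simp only [one_mul]; rw [← Finset.sum_div, ← hS, div_self hSα.ne']
  have h2 : ∑ i, ∑ j, w i j * (β j / T) ≤ 1 := by
    rw [Finset.sum_comm]
    calc _ = ∑ j, (∑ i, w i j) * (β j / T) := by simp only [Finset.sum_mul]
      _ ≤ ∑ j, 1 * (β j / T) := Finset.sum_le_sum fun j _ =>
          mul_le_mul_of_nonneg_right (hcol j) (div_nonneg (hβ j) hSβ.le)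
      _ = 1 := by simp only [one_mul]; rw [← Finset.sum_div, ← hT, div_self hSβ.ne']
  calc _ ≤ ∑ i, ∑ j, w i j * (S ^ u * T ^ (1 - u) * (u * (α i / S) + (1 - u) * (β j / T))) :=
        Finset.sum_le_sum fun i _ => Finset.sum_le_sum fun j _ =>
          mul_le_mul_of_nonneg_left (key i j) (hw i j)
    _ = S ^ u * T ^ (1 - u) * (u * (∑ i, ∑ j, w i j * (α i / S)) +
          (1 - u) * ∑ i, ∑ j, w i j * (β j / T)) := by
        simp only [Finset.mul_sum, ← Finset.sum_add_distrib]
        refine Finset.sum_congr rfl fun i _ => Finset.sum_congr rfl fun j _ => by ring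
    _ ≤ S ^ u * T ^ (1 - u) * (u * 1 + (1 - u) * 1) := by
        have := sub_nonneg.2 hu1
        gcongr
    _ = _ := by ring

lemma trace_mul_diagonal_mul_mul_diagonal (C D : Matrix n n ℂ) (f g : n → ℂ) :
    (C * diagonal f * D * diagonal g).trace = ∑ i, ∑ j, C j i * D i j * (f i * g j) := by
  rw [Finset.sum_comm, trace]
  refine Finset.sum_congr rfl fun j _ => ?_
  rw [diag_apply, mul_diagonal, mul_apply, Finset.sum_mul]
  refine Finset.sum_congr rfl fun i _ => ?_
  rw [mul_diagonal]
  ring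

open scoped Matrix.Norms.L2Operator in
/-- Hölder's inequality for the trace of a product of two diagonal matrices interlaced with
contractions. -/
lemma norm_trace_mul_diagonal_le {C D : Matrix n n ℂ} (hC : ‖C‖ ≤ 1) (hD : ‖D‖ ≤ 1)
    {f g : n → ℂ} {α β : n → ℝ} (hα : ∀ i, 0 ≤ α i) (hβ : ∀ j, 0 ≤ β j)
    (hSα : 0 < ∑ i, α i) (hSβ : 0 < ∑ j, β j) {u : ℝ} (hu0 : 0 ≤ u) (hu1 : u ≤ 1)
    (hf : ∀ i, ‖f i‖ ≤ α i ^ u) (hg : ∀ j, ‖g j‖ ≤ β j ^ (1 - u)) :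
    ‖(C * diagonal f * D * diagonal g).trace‖ ≤ (∑ i, α i) ^ u * (∑ j, β j) ^ (1 - u) := by
  -- Rows and columns of a contraction have Euclidean norm at most one, so this makes the weights
  -- doubly substochastic.
  have hw : ∀ i j, ‖C j i‖ * ‖D i j‖ ≤ (‖C j i‖ ^ 2 + ‖D i j‖ ^ 2) / 2 := fun i j => by
    nlinarith [sq_nonneg (‖C j i‖ - ‖D i j‖)]
  rw [trace_mul_diagonal_mul_mul_diagonal]
  refine le_trans ?_ (sum_mul_rpow_mul_rpow_le (w := fun i j => ‖C j i‖ * ‖D i j‖)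
    (fun i j => by positivity) (fun i => ?_) (fun j => ?_) hα hβ hSα hSβ hu0 hu1)
  · refine (norm_sum_le _ _).trans (Finset.sum_le_sum fun i _ =>
      (norm_sum_le _ _).trans (Finset.sum_le_sum fun j _ => ?_))
    rw [norm_mul, norm_mul, norm_mul]
    gcongr
    · exact Real.rpow_nonneg (hα i) u
    · exact hf i
    · exact hg j
  · have h1 := sum_norm_sq_col_le_one hC i
    have h2 := sum_norm_sq_row_le_one hD i
    calc _ ≤ ∑ j, (‖C j i‖ ^ 2 + ‖D i j‖ ^ 2) / 2 := Finset.sum_le_sum fun j _ => hw i j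
      _ = (∑ j, ‖C j i‖ ^ 2 + ∑ j, ‖D i j‖ ^ 2) / 2 := by
          rw [← Finset.sum_div, Finset.sum_add_distrib]
      _ ≤ 1 := by linarith
  · have h1 := sum_norm_sq_row_le_one hC j
    have h2 := sum_norm_sq_col_le_one hD j
    calc _ ≤ ∑ i, (‖C j i‖ ^ 2 + ‖D i j‖ ^ 2) / 2 := Finset.sum_le_sum fun i _ => hw i j
      _ = (∑ i, ‖C j i‖ ^ 2 + ∑ i, ‖D i j‖ ^ 2) / 2 := by
          rw [← Finset.sum_div, Finset.sum_add_distrib]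
      _ ≤ 1 := by linarith

/-- Cyclicity of the trace lets the eigenvector unitaries be absorbed into the interlaced factors,
leaving diagonal matrices. -/
lemma trace_mul_complexCfc {H L : Matrix n n ℂ} (hH : H.IsHermitian) (hL : L.IsHermitian)
    (K₁ K₂ : Matrix n n ℂ) (f g : ℝ → ℂ) :
    (K₁ * hH.complexCfc f * K₂ * hL.complexCfc g).trace =
      (hL.eigenvectorUnitary.1ᴴ * K₁ * hH.eigenvectorUnitary.1 *
        diagonal (fun i => f (hH.eigenvalues i)) *
        (hH.eigenvectorUnitary.1ᴴ * K₂ * hL.eigenvectorUnitary.1) *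
        diagonal (fun i => g (hL.eigenvalues i))).trace := by
  simp only [IsHermitian.complexCfc, ← Matrix.mul_assoc]
  rw [trace_mul_comm]
  simp only [Matrix.mul_assoc]

open scoped Matrix.Norms.L2Operator in
/-- Hölder's inequality for the trace of a product of functions of two Hermitian matrices
interlaced with contractions. -/
lemma norm_trace_mul_complexCfc_le {H L K₁ K₂ : Matrix n n ℂ} (hH : H.IsHermitian)
    (hL : L.IsHermitian) (hK₁ : ‖K₁‖ ≤ 1) (hK₂ : ‖K₂‖ ≤ 1)
    {f g : ℝ → ℂ} {α β : n → ℝ} (hα : ∀ i, 0 ≤ α i) (hβ : ∀ j, 0 ≤ β j)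
    (hSα : 0 < ∑ i, α i) (hSβ : 0 < ∑ j, β j) {u : ℝ} (hu0 : 0 ≤ u) (hu1 : u ≤ 1)
    (hf : ∀ i, ‖f (hH.eigenvalues i)‖ ≤ α i ^ u)
    (hg : ∀ j, ‖g (hL.eigenvalues j)‖ ≤ β j ^ (1 - u)) :
    ‖(K₁ * hH.complexCfc f * K₂ * hL.complexCfc g).trace‖ ≤
      (∑ i, α i) ^ u * (∑ j, β j) ^ (1 - u) := by
  have hU := hH.norm_eigenvectorUnitary_le_one
  have hW := hL.norm_eigenvectorUnitary_le_one
  have hU' : ‖hH.eigenvectorUnitary.1ᴴ‖ ≤ 1 := (l2_opNorm_conjTranspose _).le.trans hU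
  have hW' : ‖hL.eigenvectorUnitary.1ᴴ‖ ≤ 1 := (l2_opNorm_conjTranspose _).le.trans hW
  have h3 : ∀ {P Q R : Matrix n n ℂ}, ‖P‖ ≤ 1 → ‖Q‖ ≤ 1 → ‖R‖ ≤ 1 → ‖P * Q * R‖ ≤ 1 := by
    intro P Q R hP hQ hR
    calc _ ≤ ‖P‖ * ‖Q‖ * ‖R‖ := norm_mul₃_le
      _ ≤ 1 * 1 * 1 := by gcongr
      _ = 1 := by norm_num
  have hC := h3 hW' hK₁ hU
  have hD := h3 hU' hK₂ hW
  have h := norm_trace_mul_diagonal_le hC hD (f := fun i => f (hH.eigenvalues i))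
    (g := fun j => g (hL.eigenvalues j)) hα hβ hSα hSβ hu0 hu1 hf hg
  rwa [trace_mul_complexCfc hH hL]

open scoped Matrix.Norms.L2Operator in
/-- The contraction in the polar decomposition of `Y`. -/
lemma exists_polar (Y : Matrix n n ℂ) {H : Matrix n n ℂ} (hH : H.PosSemidef) (hY : Yᴴ * Y = H) :
    ‖Y * hH.1.complexCfc (suppPow (-(1 / 2 : ℝ) : ℝ))‖ ≤ 1 ∧
      Y * hH.1.complexCfc (suppPow (-(1 / 2 : ℝ) : ℝ)) * hH.1.complexCfc (suppPow (1 / 2 : ℝ)) =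
        Y := by
  set P : ℂ → Matrix n n ℂ := fun z => hH.1.complexCfc (suppPow z) with hP
  have hmul : ∀ z w, P z * P w = P (z + w) := hH.1.complexCfc_suppPow_mul
  have hstar : ∀ r : ℝ, (P r)ᴴ = P r := hH.1.conjTranspose_complexCfc_suppPow
  have hone : P 1 = H := hH.complexCfc_suppPow_one
  constructor
  · change ‖Y * P _‖ ≤ 1
    -- The Gram matrix `H^(-1/2) H H^(-1/2)` is the support projection of `H`.
    have h1 : (Y * P (-(1 / 2 : ℝ) : ℝ))ᴴ * (Y * P (-(1 / 2 : ℝ) : ℝ)) = P 0 := by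
      rw [conjTranspose_mul, hstar, Matrix.mul_assoc, ← Matrix.mul_assoc Yᴴ, hY]
      rw [← hone, hmul, hmul]
      congr 1
      push_cast
      ring
    have h2 : ‖P 0‖ ≤ 1 := hH.1.norm_complexCfc_le_one fun i => by
      simpa using norm_suppPow_le (z := 0) (hH.eigenvalues_nonneg i)
    rw [← h1, l2_opNorm_conjTranspose_mul_self] at h2
    nlinarith [norm_nonneg (Y * P (-(1 / 2 : ℝ) : ℝ))]
  · change Y * P _ * P _ = Y
    rw [Matrix.mul_assoc, hmul]
    have h0 : ((-(1 / 2 : ℝ) : ℝ) : ℂ) + ((1 / 2 : ℝ) : ℂ) = 0 := by push_cast; ring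
    have hst0 : (P 0)ᴴ = P 0 := by simpa using hstar 0
    -- `Y * P 0 = Y` because the Gram matrix of the difference vanishes.
    rw [h0, ← sub_eq_zero, ← Matrix.conjTranspose_mul_self_eq_zero]
    rw [conjTranspose_sub, conjTranspose_mul, hst0]
    have e1 : H * P 0 = H := by rw [← hone, hmul, add_zero]
    have e2 : P 0 * H = H := by rw [← hone, hmul, zero_add]
    calc _ = P 0 * (Yᴴ * Y) * P 0 - P 0 * (Yᴴ * Y) - (Yᴴ * Y) * P 0 + Yᴴ * Y := by
          noncomm_ring
      _ = 0 := by rw [hY, e2, e1]; abel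

end Matrix

/-! ### Three lines interpolation. -/

lemma norm_suppPow_le_exp {z : ℂ} {R : ℝ} (hz : |z.re| ≤ R) (x : ℝ) :
    ‖suppPow z x‖ ≤ Real.exp (R * |Real.log x|) := by
  by_cases h0 : x = 0
  · simp only [suppPow, h0, if_true, norm_zero]
    positivity
  · rw [suppPow, if_neg h0, Complex.norm_exp, Real.exp_le_exp, Complex.re_mul_ofReal]
    calc z.re * Real.log x ≤ |z.re * Real.log x| := le_abs_self _
      _ = |z.re| * |Real.log x| := abs_mul _ _
      _ ≤ _ := by gcongr

namespace Matrix

variable {n : Type*} [Fintype n] [DecidableEq n]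

-- The boundary estimate. The imaginary part of `w` only contributes a contraction `B^(i Im w)`; the
-- real part gives `Y = V₀ H₀^(1/2)`. Hölder with exponents `1/u` and `1/(1-u)` then bounds the
-- trace uniformly on a vertical line.
open scoped Matrix.Norms.L2Operator in
lemma norm_trace_polar_le {C B H₀ H V : Matrix n n ℂ} (hB : B.PosSemidef) (hH₀ : H₀.PosSemidef)
    (hH : H.PosSemidef) (hV : ‖V‖ ≤ 1) {u t : ℝ} (hu0 : 0 < u) (hu1 : u ≤ 1)
    (hY : (C * hB.1.complexCfc (suppPow (u - 1 / 2 : ℝ)))ᴴ *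
      (C * hB.1.complexCfc (suppPow (u - 1 / 2 : ℝ))) = H₀)
    (hS₀ : 0 < ∑ i, hH₀.1.eigenvalues i ^ (1 / (2 * u)))
    (hS : 0 < ∑ i, hH.1.eigenvalues i ^ t) {w v : ℂ} (hw : w.re = u - 1 / 2)
    (hv : v.re = t * (1 - u)) :
    ‖(Vᴴ * C * hB.1.complexCfc (suppPow w) * 1 * hH.1.complexCfc (suppPow v)).trace‖ ≤
      (∑ i, hH₀.1.eigenvalues i ^ (1 / (2 * u))) ^ u *
        (∑ i, hH.1.eigenvalues i ^ t) ^ (1 - u) := by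
  obtain ⟨hV₀, hpolar⟩ := exists_polar _ hH₀ hY
  set Y := C * hB.1.complexCfc (suppPow (u - 1 / 2 : ℝ)) with hYdef
  set V₀ := Y * hH₀.1.complexCfc (suppPow (-(1 / 2 : ℝ) : ℝ))
  have hsplit : C * hB.1.complexCfc (suppPow w) =
      V₀ * hH₀.1.complexCfc (suppPow (1 / 2 : ℝ)) *
        hB.1.complexCfc (suppPow (w.im * Complex.I)) := by
    rw [hpolar, hYdef, Matrix.mul_assoc, IsHermitian.complexCfc_suppPow_mul, ← hw,
      Complex.re_add_im]
  have hK₁ : ‖Vᴴ * V₀‖ ≤ 1 := by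
    calc _ ≤ ‖Vᴴ‖ * ‖V₀‖ := norm_mul_le _ _
      _ ≤ 1 * 1 := by
        gcongr
        exact (l2_opNorm_conjTranspose V).le.trans hV
      _ = 1 := one_mul 1
  have hK₂ : ‖hB.1.complexCfc (suppPow (w.im * Complex.I))‖ ≤ 1 :=
    hB.1.norm_complexCfc_le_one fun i => by
      simpa using norm_suppPow_le (z := w.im * Complex.I) (hB.eigenvalues_nonneg i)
  have h := norm_trace_mul_complexCfc_le hH₀.1 hH.1 hK₁ hK₂ (f := suppPow (1 / 2 : ℝ))
    (g := suppPow v) (α := fun i => hH₀.1.eigenvalues i ^ (1 / (2 * u)))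
    (β := fun i => hH.1.eigenvalues i ^ t)
    (fun i => Real.rpow_nonneg (hH₀.eigenvalues_nonneg i) _)
    (fun i => Real.rpow_nonneg (hH.eigenvalues_nonneg i) _) hS₀ hS hu0.le hu1
    (fun i => by
      refine (norm_suppPow_le (hH₀.eigenvalues_nonneg i)).trans_eq ?_
      rw [← Real.rpow_mul (hH₀.eigenvalues_nonneg i), Complex.ofReal_re]
      congr 1
      field_simp)
    (fun i => by
      refine (norm_suppPow_le (hH.eigenvalues_nonneg i)).trans_eq ?_
      rw [← Real.rpow_mul (hH.eigenvalues_nonneg i), hv])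
  refine le_of_eq_of_le ?_ h
  rw [Matrix.mul_one, Matrix.mul_assoc Vᴴ, hsplit]
  simp only [Matrix.mul_assoc]

/-- Complex interpolation for the functions `u ↦ tr |C B ^ (u - 1/2)| ^ (1/u)`. -/
lemma trace_interpolation {C B H₀ H₁ H : Matrix n n ℂ} (hB : B.PosSemidef)
    (hH₀ : H₀.PosSemidef) (hH₁ : H₁.PosSemidef) (hH : H.PosSemidef) {u₀ u₁ u θ : ℝ}
    (hu₀ : u₀ ∈ Set.Icc (1 / 2 : ℝ) 1) (hu₁ : u₁ ∈ Set.Icc (1 / 2 : ℝ) 1)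
    (hθ : θ ∈ Set.Icc (0 : ℝ) 1) (hu : u = (1 - θ) * u₀ + θ * u₁)
    (hY₀ : (C * hB.1.complexCfc (suppPow (u₀ - 1 / 2 : ℝ)))ᴴ *
      (C * hB.1.complexCfc (suppPow (u₀ - 1 / 2 : ℝ))) = H₀)
    (hY₁ : (C * hB.1.complexCfc (suppPow (u₁ - 1 / 2 : ℝ)))ᴴ *
      (C * hB.1.complexCfc (suppPow (u₁ - 1 / 2 : ℝ))) = H₁)
    (hY : (C * hB.1.complexCfc (suppPow (u - 1 / 2 : ℝ)))ᴴ *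
      (C * hB.1.complexCfc (suppPow (u - 1 / 2 : ℝ))) = H)
    (hS₀ : 0 < ∑ i, hH₀.1.eigenvalues i ^ (1 / (2 * u₀)))
    (hS₁ : 0 < ∑ i, hH₁.1.eigenvalues i ^ (1 / (2 * u₁)))
    (hS : 0 < ∑ i, hH.1.eigenvalues i ^ (1 / (2 * u))) :
    ∑ i, hH.1.eigenvalues i ^ (1 / (2 * u)) ≤
      ((∑ i, hH₀.1.eigenvalues i ^ (1 / (2 * u₀))) ^ u₀ *
        (∑ i, hH.1.eigenvalues i ^ (1 / (2 * u))) ^ (1 - u₀)) ^ (1 - θ) *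
      ((∑ i, hH₁.1.eigenvalues i ^ (1 / (2 * u₁))) ^ u₁ *
        (∑ i, hH.1.eigenvalues i ^ (1 / (2 * u))) ^ (1 - u₁)) ^ θ := by
  have hupos : 0 < u := by
    rw [hu]; nlinarith [hu₀.1, hu₁.1, hθ.1, hθ.2]
  obtain ⟨hV, -⟩ := exists_polar _ hH hY
  set Y := C * hB.1.complexCfc (suppPow (u - 1 / 2 : ℝ)) with hYdef
  set V := Y * hH.1.complexCfc (suppPow (-(1 / 2 : ℝ) : ℝ)) with hVdef
  set t : ℝ := 1 / (2 * u) with ht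
  -- With `u_z = u₀ + z (u₁ - u₀)`, these are `w = u_z - 1/2` and `v = t (1 - u_z)`: on the boundary
  -- lines their real parts match the Hölder exponents.
  set w : ℂ → ℂ := fun z => (u₀ - 1 / 2 : ℝ) + z * (u₁ - u₀ : ℝ) with hw
  set v : ℂ → ℂ := fun z => (t * (1 - u₀) : ℝ) - z * (t * (u₁ - u₀) : ℝ) with hv
  have hwre : ∀ z, (w z).re = u₀ - 1 / 2 + z.re * (u₁ - u₀) := fun z => by
    simp only [hw, Complex.add_re, Complex.ofReal_re, Complex.re_mul_ofReal]
  have hvre : ∀ z, (v z).re = t * (1 - u₀) - z.re * (t * (u₁ - u₀)) := fun z => by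
    simp only [hv, Complex.sub_re, Complex.ofReal_re, Complex.re_mul_ofReal]
  set G : ℂ → ℂ := fun z =>
    (Vᴴ * C * hB.1.complexCfc (suppPow (w z)) * 1 * hH.1.complexCfc (suppPow (v z))).trace with hG
  set P := hH.1.eigenvectorUnitary.1ᴴ * (Vᴴ * C) * hB.1.eigenvectorUnitary.1
  set Q := hB.1.eigenvectorUnitary.1ᴴ * 1 * hH.1.eigenvectorUnitary.1
  have hGsum : G = fun z => ∑ i, ∑ j, P j i * Q i j *
      (suppPow (w z) (hB.1.eigenvalues i) * suppPow (v z) (hH.1.eigenvalues j)) := by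
    funext z
    simp only [hG]
    rw [trace_mul_complexCfc, trace_mul_diagonal_mul_mul_diagonal]
  have hdiff : Differentiable ℂ G := by
    rw [hGsum]
    have hw' : Differentiable ℂ w := by fun_prop
    have hv' : Differentiable ℂ v := by fun_prop
    have h1 : ∀ x, Differentiable ℂ fun z => suppPow (w z) x := fun x =>
      (differentiable_suppPow x).comp hw'
    have h2 : ∀ x, Differentiable ℂ fun z => suppPow (v z) x := fun x =>
      (differentiable_suppPow x).comp hv'
    fun_prop
  have hbdd : BddAbove ((norm ∘ G) '' Complex.HadamardThreeLines.verticalClosedStrip 0 1) := by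
    set R := |u₀ - 1 / 2| + |u₁ - u₀| + |t * (1 - u₀)| + |t * (u₁ - u₀)| with hR
    refine ⟨∑ i, ∑ j, ‖P j i * Q i j‖ * (Real.exp (R * |Real.log (hB.1.eigenvalues i)|) *
      Real.exp (R * |Real.log (hH.1.eigenvalues j)|)), ?_⟩
    rintro _ ⟨z, hz, rfl⟩
    have hz0 : 0 ≤ z.re := hz.1
    have hz1 : z.re ≤ 1 := hz.2
    have hzabs : |z.re| ≤ 1 := abs_le.2 ⟨by linarith, hz1⟩
    have hmul : ∀ a : ℝ, |z.re * a| ≤ |a| := fun a => by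
      rw [abs_mul]
      exact mul_le_of_le_one_left (abs_nonneg a) hzabs
    have hwR : |(w z).re| ≤ R := by
      rw [hwre]
      have := abs_add_le (u₀ - 1 / 2) (z.re * (u₁ - u₀))
      have := hmul (u₁ - u₀)
      have := abs_nonneg (t * (1 - u₀))
      have := abs_nonneg (t * (u₁ - u₀))
      linarith
    have hvR : |(v z).re| ≤ R := by
      rw [hvre]
      have := abs_sub (t * (1 - u₀)) (z.re * (t * (u₁ - u₀)))
      have := hmul (t * (u₁ - u₀))
      have := abs_nonneg (u₀ - 1 / 2)
      have := abs_nonneg (u₁ - u₀)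
      linarith
    rw [Function.comp_apply, hGsum]
    refine (norm_sum_le _ _).trans (Finset.sum_le_sum fun i _ =>
      (norm_sum_le _ _).trans (Finset.sum_le_sum fun j _ => ?_))
    rw [norm_mul, norm_mul (suppPow _ _)]
    gcongr
    · exact norm_suppPow_le_exp hwR _
    · exact norm_suppPow_le_exp hvR _
  -- At `θ` the product collapses to `H^(-1/2) H H^(t-1/2) = H^t`, since `t * u = 1/2`.
  have hval : G θ = ((∑ i, hH.1.eigenvalues i ^ t : ℝ) : ℂ) := by
    have hwθ : w θ = (u - 1 / 2 : ℝ) := by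
      simp only [hw]
      rw [hu]
      push_cast
      ring
    have hvθ : v θ = (t - 1 / 2 : ℝ) := by
      have h : t * u = 1 / 2 := by rw [ht]; field_simp
      simp only [hv]
      rw [← h, hu]
      push_cast
      ring
    have hVst : Vᴴ = hH.1.complexCfc (suppPow (-(1 / 2 : ℝ) : ℝ)) * Yᴴ := by
      rw [hVdef, conjTranspose_mul, hH.1.conjTranspose_complexCfc_suppPow]
    have hmat : Vᴴ * C * hB.1.complexCfc (suppPow (w θ)) * 1 * hH.1.complexCfc (suppPow (v θ)) =
        hH.1.complexCfc (suppPow t) := by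
      rw [hwθ, hvθ, Matrix.mul_one, Matrix.mul_assoc Vᴴ, ← hYdef, hVst, Matrix.mul_assoc _ Yᴴ, hY]
      have hone := hH.complexCfc_suppPow_one
      calc _ = hH.1.complexCfc (suppPow (-(1 / 2 : ℝ) : ℝ)) * hH.1.complexCfc (suppPow 1) *
            hH.1.complexCfc (suppPow (t - 1 / 2 : ℝ)) := by rw [hone]
        _ = _ := by
            rw [IsHermitian.complexCfc_suppPow_mul, IsHermitian.complexCfc_suppPow_mul]
            congr 2
            push_cast
            ring
    have htpos : t ≠ 0 := by rw [ht]; positivity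
    simp only [hG]
    rw [hmat, IsHermitian.trace_complexCfc]
    push_cast
    refine Finset.sum_congr rfl fun i _ => ?_
    rw [suppPow_ofReal (hH.eigenvalues_nonneg i) fun _ => htpos]
  have h := Complex.HadamardThreeLines.norm_le_interp_of_mem_verticalClosedStrip'
    (f := G) (z := (θ : ℂ)) (l := 0) (u := 1) zero_lt_one
    (by simpa [Complex.HadamardThreeLines.verticalClosedStrip] using hθ)
    hdiff.diffContOnCl hbdd
    (fun z hz => norm_trace_polar_le hB hH₀ hH hV (by linarith [hu₀.1]) hu₀.2 hY₀ hS₀ hS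
      (by rw [hwre, show z.re = 0 from hz]; ring) (by rw [hvre, show z.re = 0 from hz]; ring))
    (fun z hz => norm_trace_polar_le hB hH₁ hH hV (by linarith [hu₁.1]) hu₁.2 hY₁ hS₁ hS
      (by rw [hwre, show z.re = 1 from hz]; ring) (by rw [hvre, show z.re = 1 from hz]; ring))
  rw [hval, Complex.norm_real, Real.norm_of_nonneg hS.le] at h
  simpa using h

end Matrix

/-! ### The quasi-entropy as a trace of powers of Gram matrices. -/

namespace Matrix

variable {n : Type*} [Fintype n] [DecidableEq n]

lemma mul_eq_zero_of_matrixSupport_le {A B C : Matrix n n ℂ}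
    (hAB : matrixSupport A ≤ matrixSupport B) (h : B * C = 0) : A * C = 0 := by
  have hker : LinearMap.ker (Matrix.toEuclideanLin B) ≤ LinearMap.ker (Matrix.toEuclideanLin A) :=
    Submodule.orthogonal_le_orthogonal_iff.1 hAB
  ext i j
  have hB : Matrix.toEuclideanLin B (WithLp.toLp 2 fun k => C k j) = 0 := by
    ext k
    have := congrFun (congrFun h k) j
    simpa [Matrix.mul_apply, Matrix.mulVec, dotProduct] using this
  have hA : Matrix.toEuclideanLin A (WithLp.toLp 2 fun k => C k j) = 0 := hker hB
  have := congrArg (fun x : EuclideanSpace ℂ n => x i) hA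
  simpa [Matrix.mul_apply, Matrix.mulVec, dotProduct] using this

/-- The columns of `1 - P`, with `P` the support projection of `B`, lie in `ker B`, hence in `ker
A`. -/
lemma mul_complexCfc_suppPow_zero {A B : Matrix n n ℂ} (hB : B.PosSemidef)
    (hAB : matrixSupport A ≤ matrixSupport B) : A * hB.1.complexCfc (suppPow 0) = A := by
  have h : B * (1 - hB.1.complexCfc (suppPow 0)) = 0 := by
    rw [Matrix.mul_sub, Matrix.mul_one, sub_eq_zero]
    nth_rewrite 2 [← hB.complexCfc_suppPow_one]
    rw [IsHermitian.complexCfc_suppPow_mul, add_zero, hB.complexCfc_suppPow_one]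
  have h' := mul_eq_zero_of_matrixSupport_le hAB h
  rw [Matrix.mul_sub, Matrix.mul_one, sub_eq_zero] at h'
  exact h'.symm

lemma complexCfc_suppPow_zero_mul {A B : Matrix n n ℂ} (hA : A.PosSemidef) (hB : B.PosSemidef)
    (hAB : matrixSupport A ≤ matrixSupport B) : hB.1.complexCfc (suppPow 0) * A = A := by
  have h := congrArg conjTranspose (mul_complexCfc_suppPow_zero hB hAB)
  have h0 := hB.1.conjTranspose_complexCfc_suppPow 0
  rw [Complex.ofReal_zero] at h0
  rwa [conjTranspose_mul, hA.1.eq, h0] at h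

/-- The Gram matrix of `A ^ (1/2) B ^ (u - 1/2)`. -/
noncomputable def sandwich {A B : Matrix n n ℂ} (hA : A.PosSemidef) (hB : B.PosSemidef) (u : ℝ) :
    Matrix n n ℂ :=
  (hA.1.complexCfc (suppPow (1 / 2 : ℝ)) * hB.1.complexCfc (suppPow (u - 1 / 2 : ℝ)))ᴴ *
    (hA.1.complexCfc (suppPow (1 / 2 : ℝ)) * hB.1.complexCfc (suppPow (u - 1 / 2 : ℝ)))

variable {A B : Matrix n n ℂ} (hA : A.PosSemidef) (hB : B.PosSemidef)

lemma posSemidef_sandwich (u : ℝ) : (sandwich hA hB u).PosSemidef :=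
  posSemidef_conjTranspose_mul_self _

lemma sandwich_eq (u : ℝ) :
    sandwich hA hB u = hB.1.complexCfc (suppPow (u - 1 / 2 : ℝ)) * A *
      hB.1.complexCfc (suppPow (u - 1 / 2 : ℝ)) := by
  have h : hA.1.complexCfc (suppPow (1 / 2 : ℝ)) * hA.1.complexCfc (suppPow (1 / 2 : ℝ)) = A := by
    rw [IsHermitian.complexCfc_suppPow_mul]
    conv_rhs => rw [← hA.complexCfc_suppPow_one]
    congr 2
    push_cast
    ring
  rw [sandwich, conjTranspose_mul, hA.1.conjTranspose_complexCfc_suppPow,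
    hB.1.conjTranspose_complexCfc_suppPow]
  calc _ = hB.1.complexCfc (suppPow (u - 1 / 2 : ℝ)) *
        (hA.1.complexCfc (suppPow (1 / 2 : ℝ)) * hA.1.complexCfc (suppPow (1 / 2 : ℝ))) *
        hB.1.complexCfc (suppPow (u - 1 / 2 : ℝ)) := by simp only [Matrix.mul_assoc]
    _ = _ := by rw [h]

/-- Conjugation by the inverse power of `B` on its support recovers `A`. -/
lemma sandwich_ne_zero (hAB : matrixSupport A ≤ matrixSupport B) (hA0 : A ≠ 0) (u : ℝ) :
    sandwich hA hB u ≠ 0 := by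
  intro h
  rw [sandwich_eq] at h
  apply hA0
  have h1 : hB.1.complexCfc (suppPow (-(u - 1 / 2) : ℝ)) *
      hB.1.complexCfc (suppPow (u - 1 / 2 : ℝ)) = hB.1.complexCfc (suppPow 0) := by
    rw [IsHermitian.complexCfc_suppPow_mul, Complex.ofReal_neg, neg_add_cancel]
  have h2 : hB.1.complexCfc (suppPow (u - 1 / 2 : ℝ)) *
      hB.1.complexCfc (suppPow (-(u - 1 / 2) : ℝ)) = hB.1.complexCfc (suppPow 0) := by
    rw [IsHermitian.complexCfc_suppPow_mul, Complex.ofReal_neg, add_neg_cancel]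
  calc A = hB.1.complexCfc (suppPow 0) * A * hB.1.complexCfc (suppPow 0) := by
        rw [complexCfc_suppPow_zero_mul hA hB hAB, mul_complexCfc_suppPow_zero hB hAB]
    _ = hB.1.complexCfc (suppPow (-(u - 1 / 2) : ℝ)) *
        (hB.1.complexCfc (suppPow (u - 1 / 2 : ℝ)) * A *
          hB.1.complexCfc (suppPow (u - 1 / 2 : ℝ))) *
        hB.1.complexCfc (suppPow (-(u - 1 / 2) : ℝ)) := by
        conv_lhs =>
          congr
          · rw [← h1]
          · rw [← h2]
        simp only [Matrix.mul_assoc]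
    _ = 0 := by rw [h, Matrix.mul_zero, Matrix.zero_mul]

/-- The substitution `u = 1/(2t)`; the exponent `1/(2u)` is left unsimplified to match
`trace_interpolation`. -/
lemma sandwichedQuasiEntropy_eq (hAB : matrixSupport A ≤ matrixSupport B) {t : ℝ} (ht : 0 < t) :
    sandwichedQuasiEntropy A B t =
      ∑ i, (posSemidef_sandwich hA hB (1 / (2 * t))).1.eigenvalues i ^
        (1 / (2 * (1 / (2 * t)))) := by
  have hM : B ^ ((1 - t) / (2 * t)) * A * B ^ ((1 - t) / (2 * t)) =
      sandwich hA hB (1 / (2 * t)) := by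
    rw [sandwich_eq]
    have he : 1 / (2 * t) - 1 / 2 = (1 - t) / (2 * t) := by field_simp
    rw [he]
    -- At `t = 1` the power `B ^ 0` is the identity while `suppPow 0` gives the support projection;
    -- they agree next to `A`.
    by_cases h : (1 - t) / (2 * t) = 0
    · rw [h, CFC.rpow_zero B hB.nonneg, Complex.ofReal_zero,
        complexCfc_suppPow_zero_mul hA hB hAB, mul_complexCfc_suppPow_zero hB hAB,
        Matrix.one_mul, Matrix.mul_one]
    · rw [hB.complexCfc_suppPow_ofReal h]
  have he : 1 / (2 * (1 / (2 * t))) = t := by field_simp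
  rw [sandwichedQuasiEntropy, hM, (posSemidef_sandwich hA hB _).trace_rpow, Complex.ofReal_re, he]

lemma PosSemidef.sum_eigenvalues_rpow_pos {H : Matrix n n ℂ} (hH : H.PosSemidef) (h0 : H ≠ 0)
    (t : ℝ) : 0 < ∑ i, hH.1.eigenvalues i ^ t := by
  obtain ⟨i, hi⟩ := Function.ne_iff.1 (mt hH.1.eigenvalues_eq_zero_iff.1 h0)
  exact Finset.sum_pos' (fun i _ => Real.rpow_nonneg (hH.eigenvalues_nonneg i) t)
    ⟨i, Finset.mem_univ i, Real.rpow_pos_of_pos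
      (lt_of_le_of_ne (hH.eigenvalues_nonneg i) (Ne.symm hi)) t⟩

end Matrix

/-! ### Positivity and log-convexity. -/

lemma IsDensityMatrix.ne_zero {n : Type*} [Fintype n] {A : Matrix n n ℂ} (hA : IsDensityMatrix A) :
    A ≠ 0 := by
  rintro rfl
  simpa using hA.2

lemma sandwichedQuasiEntropy_pos {n : Type*} [Fintype n] [DecidableEq n] {A B : Matrix n n ℂ}
    (hA : IsDensityMatrix A) (hB : IsDensityMatrix B)
    (hAB : matrixSupport A ≤ matrixSupport B) {t : ℝ} (ht : 0 < t) :
    0 < sandwichedQuasiEntropy A B t := by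
  rw [Matrix.sandwichedQuasiEntropy_eq hA.1 hB.1 hAB ht]
  exact (Matrix.posSemidef_sandwich hA.1 hB.1 _).sum_eigenvalues_rpow_pos
    (Matrix.sandwich_ne_zero hA.1 hB.1 hAB hA.ne_zero _) _

theorem theoremt7 {n : Type*} [Fintype n] [DecidableEq n] (A B : Matrix n n ℂ)
    (hA : IsDensityMatrix A) (hB : IsDensityMatrix B)
    (hAB : matrixSupport A ≤ matrixSupport B) :
    (∀ t ∈ Set.Icc (1 / 2 : ℝ) 1, 0 < sandwichedQuasiEntropy A B t) ∧
      ConvexOn ℝ (Set.Icc (1 / 2 : ℝ) 1)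
        (fun t : ℝ => Real.log (sandwichedQuasiEntropy A B t)) := by
  have hpos : ∀ {t : ℝ}, 0 < t → 0 < sandwichedQuasiEntropy A B t :=
    fun ht => sandwichedQuasiEntropy_pos hA hB hAB ht
  have hInv : ∀ {t : ℝ}, t ∈ Set.Icc (1 / 2 : ℝ) 1 → 1 / (2 * t) ∈ Set.Icc (1 / 2 : ℝ) 1 := by
    rintro t ⟨h1, h2⟩
    have : 0 < t := by linarith
    constructor
    · rw [div_le_div_iff₀ (by norm_num) (by linarith)]; linarith
    · rw [div_le_one (by linarith)]; linarith
  refine ⟨fun t ht => hpos (by linarith [ht.1]), convex_Icc _ _, ?_⟩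
  intro t₀ ht₀ t₁ ht₁ a b ha hb hab
  have h0 : 0 < t₀ := by linarith [ht₀.1]
  have h1 : 0 < t₁ := by linarith [ht₁.1]
  simp only [smul_eq_mul]
  set t := a * t₀ + b * t₁ with ht
  have htpos : 0 < t := by
    have : t ∈ Set.Icc (1 / 2 : ℝ) 1 := convex_Icc _ _ ht₀ ht₁ ha hb hab
    linarith [this.1]
  -- The weight `b t₁ / t` is the one for which `1/(2t)` is the corresponding convex combination of
  -- `1/(2t₀)` and `1/(2t₁)`.
  have hθ : b * t₁ / t ∈ Set.Icc (0 : ℝ) 1 := by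
    refine ⟨by positivity, (div_le_one htpos).2 ?_⟩
    have : 0 ≤ a * t₀ := by positivity
    linarith
  have hθ' : 1 - b * t₁ / t = a * t₀ / t := by
    rw [eq_div_iff htpos.ne', sub_mul, div_mul_cancel₀ _ htpos.ne']
    linarith
  have hu : 1 / (2 * t) = (1 - b * t₁ / t) * (1 / (2 * t₀)) + b * t₁ / t * (1 / (2 * t₁)) := by
    rw [hθ']
    field_simp
    exact hab.symm
  have hF₀ := hpos h0
  have hF₁ := hpos h1
  have hF := hpos htpos
  have key : sandwichedQuasiEntropy A B t ≤
      (sandwichedQuasiEntropy A B t₀ ^ (1 / (2 * t₀)) *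
        sandwichedQuasiEntropy A B t ^ (1 - 1 / (2 * t₀))) ^ (1 - b * t₁ / t) *
      (sandwichedQuasiEntropy A B t₁ ^ (1 / (2 * t₁)) *
        sandwichedQuasiEntropy A B t ^ (1 - 1 / (2 * t₁))) ^ (b * t₁ / t) := by
    rw [Matrix.sandwichedQuasiEntropy_eq hA.1 hB.1 hAB h0] at hF₀ ⊢
    rw [Matrix.sandwichedQuasiEntropy_eq hA.1 hB.1 hAB h1] at hF₁ ⊢
    rw [Matrix.sandwichedQuasiEntropy_eq hA.1 hB.1 hAB htpos] at hF ⊢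
    exact Matrix.trace_interpolation hB.1 (Matrix.posSemidef_sandwich hA.1 hB.1 _)
      (Matrix.posSemidef_sandwich hA.1 hB.1 _) (Matrix.posSemidef_sandwich hA.1 hB.1 _)
      (hInv ht₀) (hInv ht₁) hθ hu rfl rfl rfl hF₀ hF₁ hF
  have hlog := Real.log_le_log hF key
  rw [Real.log_mul (by positivity) (by positivity), Real.log_rpow (by positivity),
    Real.log_rpow (by positivity), Real.log_mul (by positivity) (by positivity),
    Real.log_mul (by positivity) (by positivity), Real.log_rpow hF₀, Real.log_rpow hF₁,
    Real.log_rpow hF, Real.log_rpow hF, hθ'] at hlog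
  set x := Real.log (sandwichedQuasiEntropy A B t)
  set y₀ := Real.log (sandwichedQuasiEntropy A B t₀)
  set y₁ := Real.log (sandwichedQuasiEntropy A B t₁)
  -- The factors `t₀` and `t₁` in the weights cancel those in the exponents, so the logarithmic
  -- bound reads `x ≤ x + (a y₀ + b y₁ - x) / (2t)`, which is convexity.
  have e : a * t₀ / t * (1 / (2 * t₀) * y₀ + (1 - 1 / (2 * t₀)) * x) +
      b * t₁ / t * (1 / (2 * t₁) * y₁ + (1 - 1 / (2 * t₁)) * x) =
      x + (a * y₀ + b * y₁ - x) / (2 * t) := by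
    have hb' : b = 1 - a := by linarith
    field_simp
    rw [ht, hb']
    ring
  rw [e] at hlog
  have hd : 0 ≤ (a * y₀ + b * y₁ - x) / (2 * t) := by linarith
  by_contra! hlt
  exact hd.not_gt (div_neg_of_neg_of_pos (by linarith) (by positivity))
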